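/- Let $X,Y$ be random variables defined on a common probability space, with values in arbitrary measurable spaces $\mathcal X,\mathcal Y$ and joint distribution $P_{XY}$. The wringing dependence of $X$ and $Y$ is \[ \Delta(X;Y)=\inf_{Q_X,Q_Y}\ \sup_{\mathcal A\subset\mathcal X,\ \mathcal B\subset\mathcal Y}\ \inf\bigl\{\delta\ge 0:\ P_{XY}(\mathcal A\times\mathcal B)^{1+\delta}\le Q_X(\mathcal A)\,Q_Y(\mathcal B)\bigr\}, \] where $Q_X,Q_Y$ range over all probability measures on $\mathcal X,\mathcal Y$, the sets $\mathcal A,\mathcal B$ range over the measurable sets, and $\inf\emptyset=\infty$. For a real random variable $Z$ write $\|Z\|_r=(\mathbb E|Z|^r)^{1/r}$, with the usual limiting conventions at $r\in\{0,\pm\infty\}$. The hypercontractivity ribbon $\mathcal R_{X;Y}$ is the set of pairs $(r,s)$ of extended real numbers such that one of the following holds: \begin{itemize} \item $1\le s\le r$ and $\|\mathbb E[g(Y)\mid X]\|_r\le\|g(Y)\|_s$ for all measurable $g:\mathcal Y\to\mathbb R$ with $g(Y)$ integrable; \item $1\ge s\ge r$ and $\|\mathbb E[g(Y)\mid X]\|_r\ge\|g(Y)\|_s$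 for all measurable $g:\mathcal Y\to[0,\infty)$ with $g(Y)$ integrable. \end{itemize} Let \[ \Delta_{\mathrm{hyp}}(X;Y)=\inf\{\delta\in[0,1]:\ (1+1/\delta,\,1+\delta)\in\mathcal R_{X;Y}\}, \] where $1/0=\infty$. Then \[ \Delta(X;Y)\le\Delta_{\mathrm{hyp}}(X;Y). \] Moreover, for each $n$ let $X^n=(X_1,\dots,X_n)$ and $Y^n=(Y_1,\dots,Y_n)$ be such that the pairs $(X_t,Y_t)$, $t=1,\dots,n$, are i.i.d. with distribution $P_{XY}$. Then $\Delta(X^n;Y^n)$ is non-decreasing in $n$ and \[ \lim_{n\to\infty}\Delta(X^n;Y^n)=\Delta_{\mathrm{hyp}}(X;Y). \] -/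

import Mathlib

open MeasureTheory ProbabilityTheory Filter Topology
open scoped ENNReal NNReal

namespace Wringing

noncomputable section

variable {Ω 𝒳 𝒴 : Type*} [MeasurableSpace Ω] [MeasurableSpace 𝒳] [MeasurableSpace 𝒴]

/-- The wringing dependence
`Δ(X;Y) = inf_{Q_X,Q_Y} sup_{A,B} inf {δ ≥ 0 : P_{XY}(A,B)^(1+δ) ≤ Q_X(A) Q_Y(B)}`,
with values in `[0, ∞]`, so that an infimum over no `δ` is `∞`. The infimum runs over all
probability measures and the supremum over all measurable sets. -/
def wringingDependence (X : Ω → 𝒳) (Y : Ω → 𝒴) (μ : Measure Ω) : ℝ≥0∞ :=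
  ⨅ (QX : ProbabilityMeasure 𝒳) (QY : ProbabilityMeasure 𝒴),
    ⨆ (A : Set 𝒳) (_ : MeasurableSet A) (B : Set 𝒴) (_ : MeasurableSet B),
      ⨅ (δ : ℝ≥0)
        (_ : μ (X ⁻¹' A ∩ Y ⁻¹' B) ^ (1 + (δ : ℝ)) ≤ (QX : Measure 𝒳) A * (QY : Measure 𝒴) B),
        (δ : ℝ≥0∞)

/-- `‖Z‖_r = (E |Z|^r)^(1/r)` for an exponent `r ∈ [-∞, ∞]`, with the usual limiting conventions
at the three exponents where the formula has no direct meaning: the essential supremum at `∞`, the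
essential infimum at `-∞`, and the limit as `p ↓ 0` at `0` (for a probability measure `‖Z‖_p` is
monotone in `p`, so this limit is an infimum). -/
def momentNorm (Z : Ω → ℝ) (r : EReal) (μ : Measure Ω) : ℝ≥0∞ :=
  if r = ⊤ then essSup (fun ω => ‖Z ω‖ₑ) μ
  else if r = ⊥ then essInf (fun ω => ‖Z ω‖ₑ) μ
  else if r = 0 then ⨅ (p : ℝ) (_ : 0 < p), (∫⁻ ω, ‖Z ω‖ₑ ^ p ∂μ) ^ (1 / p)
  else (∫⁻ ω, ‖Z ω‖ₑ ^ r.toReal ∂μ) ^ (1 / r.toReal)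

/-- The conditional expectation `E[g(Y) | X]`. -/
def condExpGiven (X : Ω → 𝒳) (Y : Ω → 𝒴) (μ : Measure Ω) (g : 𝒴 → ℝ) : Ω → ℝ :=
  μ[fun ω => g (Y ω) | MeasurableSpace.comap X inferInstance]

/-- The hypercontractivity ribbon `R_{X;Y}`: the pairs `(r, s)` for which hypercontractivity
(`1 ≤ s ≤ r`) or reverse hypercontractivity (`r ≤ s ≤ 1`) holds. The functions `g` range over the
measurable functions for which `E[g(Y) | X]` is defined. -/
def ribbon (X : Ω → 𝒳) (Y : Ω → 𝒴) (μ : Measure Ω) : Set (EReal × EReal) :=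
  {rs | (1 ≤ rs.2 ∧ rs.2 ≤ rs.1 ∧
      ∀ g : 𝒴 → ℝ, Measurable g → Integrable (fun ω => g (Y ω)) μ →
        momentNorm (condExpGiven X Y μ g) rs.1 μ ≤ momentNorm (fun ω => g (Y ω)) rs.2 μ) ∨
    (rs.2 ≤ 1 ∧ rs.1 ≤ rs.2 ∧
      ∀ g : 𝒴 → ℝ, Measurable g → (∀ y, 0 ≤ g y) → Integrable (fun ω => g (Y ω)) μ →
        momentNorm (fun ω => g (Y ω)) rs.2 μ ≤ momentNorm (condExpGiven X Y μ g) rs.1 μ)}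

/-- `Δ_hyp(X;Y) = inf {δ ∈ [0,1] : (1 + 1/δ, 1 + δ) ∈ R_{X;Y}}`. The exponent `1 + 1/δ` is formed
in `[0, ∞]`, so that it is `∞` at `δ = 0`. -/
def hypDependence (X : Ω → 𝒳) (Y : Ω → 𝒴) (μ : Measure Ω) : ℝ≥0∞ :=
  ⨅ (δ : ℝ≥0) (_ : δ ≤ 1)
    (_ : (((1 + 1 / (δ : ℝ≥0∞) : ℝ≥0∞) : EReal), ((1 + (δ : ℝ≥0∞) : ℝ≥0∞) : EReal))
      ∈ ribbon X Y μ),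
    (δ : ℝ≥0∞)

end

end Wringing

/-!
For `0 < δ ≤ 1`, by duality, the pair `(1 + 1/δ, 1 + δ)` lies in the ribbon iff
`E[f(X) g(Y)] ≤ ‖f(X)‖_{1+δ} ‖g(Y)‖_{1+δ}` for all measurable `f, g ≥ 0`. This bilinear bound
tensorizes, and for indicator functions it is the rectangle inequality
`P(A × B)^(1+δ) ≤ P_X(A) P_Y(B)`, so `Δ(X^n;Y^n) ≤ Δ_hyp(X;Y)` for every `n`.

Conversely, suppose `Δ(X^n;Y^n) < δ` for every `n`. The reference measures `Q_X`, `Q_Y` of a long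
vector of copies of `(X, Y)` are arbitrary, but applied to the events that the `i`-th coordinate
lies in `A`, respectively `B`, and averaged over `i`, they can be replaced by the marginals: a
typical sequence visits `A` with frequency about `P_X(A)`, and the atypical sequences are
exponentially unlikely. Thus `P(A × B)^(1+δ) ≤ P_X(A) P_Y(B)`, and the same holds for every power of
`(X, Y)`. On simple functions the rectangle inequality loses against the bilinear bound only a
factor equal to the number of pairs of values; for `k`-fold products this number is polynomial in
`k`, so taking `k`-th roots gives the bilinear bound for `(X, Y)` itself.
-/

namespace Wringing

section Lebesgue

variable {Ω Ω' : Type*} {m : MeasurableSpace Ω} [mΩ : MeasurableSpace Ω] [MeasurableSpace Ω']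
  {μ : Measure Ω}

theorem lintegral_mul_eq_of_forall_setLIntegral_eq (hm : m ≤ mΩ)
    {u v f : Ω → ℝ≥0∞} (hu : AEMeasurable u μ) (hv : AEMeasurable v μ) (hf : Measurable[m] f)
    (h : ∀ s, MeasurableSet[m] s → ∫⁻ ω in s, u ω ∂μ = ∫⁻ ω in s, v ω ∂μ) :
    ∫⁻ ω, u ω * f ω ∂μ = ∫⁻ ω, v ω * f ω ∂μ := by
  have hf' : AEMeasurable f μ := (hf.mono hm le_rfl).aemeasurable
  have htrim : (μ.withDensity u).trim hm = (μ.withDensity v).trim hm := by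
    refine @Measure.ext _ m _ _ fun s hs => ?_
    rw [trim_measurableSet_eq hm hs, trim_measurableSet_eq hm hs,
      withDensity_apply _ (hm s hs), withDensity_apply _ (hm s hs), h s hs]
  calc ∫⁻ ω, u ω * f ω ∂μ
      = ∫⁻ ω, f ω ∂(μ.withDensity u) := (lintegral_withDensity_eq_lintegral_mul₀ hu hf').symm
    _ = ∫⁻ ω, f ω ∂(μ.withDensity v) := by rw [← lintegral_trim hm hf, htrim, lintegral_trim hm hf]
    _ = ∫⁻ ω, v ω * f ω ∂μ := lintegral_withDensity_eq_lintegral_mul₀ hv hf'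

theorem lintegral_enorm_condExp_mul (hm : m ≤ mΩ) [SigmaFinite (μ.trim hm)]
    {u : Ω → ℝ} (hu : Integrable u μ) (hu0 : 0 ≤ᵐ[μ] u) {f : Ω → ℝ≥0∞} (hf : Measurable[m] f) :
    ∫⁻ ω, ‖(μ[u | m]) ω‖ₑ * f ω ∂μ = ∫⁻ ω, ‖u ω‖ₑ * f ω ∂μ := by
  have hcond := condLExp_enorm m hu hu0
  refine lintegral_mul_eq_of_forall_setLIntegral_eq hm
    (stronglyMeasurable_condExp.mono hm).measurable.enorm.aemeasurable
    hu.aestronglyMeasurable.enorm hf fun s hs => ?_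
  rw [← setLIntegral_condLExp hm μ (fun ω => ‖u ω‖ₑ) hs]
  exact lintegral_congr_ae (ae_restrict_of_ae hcond.symm)

theorem rpow_le_of_le_rpow_mul {a b : ℝ≥0∞} {p q : ℝ} (hpq : p.HolderConjugate q) (ha : a ≠ ∞)
    (h : a ≤ a ^ (1 / p) * b) : a ^ (1 / q) ≤ b := by
  rcases eq_or_ne a 0 with rfl | ha0
  · simp [hpq.symm.pos]
  have hsplit : a ^ (1 / p) * a ^ (1 / q) = a := by
    rw [← ENNReal.rpow_add _ _ ha0 ha, one_div, one_div, hpq.inv_add_inv_eq_one, ENNReal.rpow_one]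
  rw [← ENNReal.mul_le_mul_iff_right (a := a ^ (1 / p)) (by simp [ha0, ha])
    (ENNReal.rpow_ne_top_of_nonneg (one_div_pos.2 hpq.pos).le ha), hsplit]
  exact h

theorem iSup_min_natCast (a : ℝ≥0∞) : ⨆ n : ℕ, min a n = a := by
  rw [← inf_iSup_eq, ENNReal.iSup_natCast, inf_top_eq]

theorem lintegral_rpow_le_of_forall_lintegral_mul_le [IsFiniteMeasure μ] {p q : ℝ}
    (hpq : p.HolderConjugate q) {u : Ω → ℝ≥0∞} (hu : Measurable u) {C : ℝ≥0∞}
    (h : ∀ f : Ω → ℝ≥0∞, Measurable f → ∫⁻ ω, f ω * u ω ∂μ ≤ (∫⁻ ω, f ω ^ p ∂μ) ^ (1 / p) * C) :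
    (∫⁻ ω, u ω ^ q ∂μ) ^ (1 / q) ≤ C := by
  have hq := hpq.symm.pos
  -- The extremal test function `u ^ (q - 1)` need not have finite norm; its truncations do.
  have hmono : Monotone fun (n : ℕ) ω => min (u ω) n ^ q := fun i j hij ω =>
    ENNReal.rpow_le_rpow (min_le_min_left _ (Nat.cast_le.2 hij)) hq.le
  have hmeas (n : ℕ) : Measurable fun ω => min (u ω) n := hu.min measurable_const
  have htrunc (n : ℕ) : (∫⁻ ω, min (u ω) n ^ q ∂μ) ^ (1 / q) ≤ C := by
    refine rpow_le_of_le_rpow_mul hpq ?_ ?_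
    · refine ne_top_of_le_ne_top (b := ∫⁻ _, (n : ℝ≥0∞) ^ q ∂μ) ?_
        (lintegral_mono fun ω => ENNReal.rpow_le_rpow (min_le_right _ _) hq.le)
      rw [lintegral_const]
      finiteness
    · calc ∫⁻ ω, min (u ω) n ^ q ∂μ
          ≤ ∫⁻ ω, min (u ω) n ^ (q - 1) * u ω ∂μ := by
            refine lintegral_mono fun ω => ?_
            dsimp only
            rw [← sub_add_cancel q 1, ENNReal.rpow_add_of_nonneg _ _ hpq.symm.sub_one_pos.le
              zero_le_one, ENNReal.rpow_one, sub_add_cancel]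
            gcongr
            exact min_le_left _ _
        _ ≤ (∫⁻ ω, min (u ω) n ^ q ∂μ) ^ (1 / p) * C := by
            simpa only [← ENNReal.rpow_mul, hpq.symm.sub_one_mul_conj] using
              h _ ((hmeas n).pow_const (q - 1))
  have hsup (ω : Ω) : u ω ^ q = ⨆ n : ℕ, min (u ω) n ^ q := by
    simpa only [iSup_min_natCast, ENNReal.orderIsoRpow_apply] using
      (ENNReal.orderIsoRpow q hq).map_iSup fun n : ℕ => min (u ω) n
  simp_rw [hsup]
  rw [lintegral_iSup (fun n => (hmeas n).pow_const q) hmono, one_div, ENNReal.rpow_inv_le_iff hq]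
  refine iSup_le fun n => ?_
  rw [← ENNReal.rpow_inv_le_iff hq, ← one_div]
  exact htrunc n

theorem eLpNorm_eq_lintegral_rpow {u : Ω → ℝ≥0∞} {p : ℝ≥0∞} (hp : p ≠ 0) (hp' : p ≠ ∞) :
    eLpNorm u p μ = (∫⁻ ω, u ω ^ p.toReal ∂μ) ^ (1 / p.toReal) := by
  simp only [eLpNorm_eq_lintegral_rpow_enorm_toReal hp hp', enorm_eq_self]

theorem measurable_eLpNorm_prodMk {ν : Measure Ω'} [SFinite ν] {p : ℝ≥0∞} (hp : p ≠ 0)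
    (hp' : p ≠ ∞) {u : Ω × Ω' → ℝ≥0∞} (hu : Measurable u) :
    Measurable fun x => eLpNorm (fun y => u (x, y)) p ν := by
  simp only [eLpNorm_eq_lintegral_rpow hp hp']
  exact (hu.pow_const _).lintegral_prod_right'.pow_const _

theorem eLpNorm_prod {ν : Measure Ω'} [SFinite ν] {p : ℝ≥0∞} (hp : p ≠ 0) (hp' : p ≠ ∞)
    {u : Ω × Ω' → ℝ≥0∞} (hu : Measurable u) :
    eLpNorm u p (μ.prod ν) = eLpNorm (fun x => eLpNorm (fun y => u (x, y)) p ν) p μ := by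
  simp only [eLpNorm_eq_lintegral_rpow hp hp', one_div, ← ENNReal.rpow_mul,
    inv_mul_cancel₀ (ENNReal.toReal_pos hp hp').ne', ENNReal.rpow_one]
  rw [lintegral_prod _ (hu.pow_const _).aemeasurable]

theorem mul_measure_rpow_le_eLpNorm {u : Ω → ℝ≥0∞} (hu : Measurable u) {p : ℝ≥0∞} (hp : p ≠ 0)
    (hp' : p ≠ ∞) (a : ℝ≥0∞) : a * μ (u ⁻¹' {a}) ^ (1 / p.toReal) ≤ eLpNorm u p μ := by
  have hind := eLpNorm_indicator_const (μ := μ) (c := a) (hu (measurableSet_singleton a)) hp hp'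
  rw [enorm_eq_self] at hind
  rw [← hind]
  refine eLpNorm_mono_enorm fun ω => ?_
  rw [enorm_eq_self, enorm_eq_self]
  exact Set.indicator_le' (fun ω hω => hω.ge) (fun _ _ => zero_le) ω

theorem lintegral_mul_eq_sum {u v : Ω → ℝ≥0∞} (hu : Measurable u) (hv : Measurable v)
    {S T : Finset ℝ≥0∞} (hS : ∀ ω, u ω ∈ S) (hT : ∀ ω, v ω ∈ T) :
    ∫⁻ ω, u ω * v ω ∂μ = ∑ a ∈ S, ∑ b ∈ T, a * b * μ (u ⁻¹' {a} ∩ v ⁻¹' {b}) := by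
  have hmeas (a b : ℝ≥0∞) : MeasurableSet (u ⁻¹' {a} ∩ v ⁻¹' {b}) :=
    (hu (measurableSet_singleton a)).inter (hv (measurableSet_singleton b))
  have hsum (ω : Ω) : u ω * v ω =
      ∑ a ∈ S, ∑ b ∈ T, (u ⁻¹' {a} ∩ v ⁻¹' {b}).indicator (fun _ => a * b) ω := by
    rw [Finset.sum_eq_single_of_mem (u ω) (hS ω), Finset.sum_eq_single_of_mem (v ω) (hT ω)]
    · simp
    · intro b _ hb
      simp [hb.symm]
    · intro a _ ha
      simp [ha.symm]
  simp_rw [hsum]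
  rw [lintegral_finsetSum _ fun a _ => Finset.measurable_fun_sum _ fun b _ =>
    measurable_const.indicator (hmeas a b)]
  refine Finset.sum_congr rfl fun a _ => ?_
  rw [lintegral_finsetSum _ fun b _ => measurable_const.indicator (hmeas a b)]
  exact Finset.sum_congr rfl fun b _ => lintegral_indicator_const (hmeas a b) _

end Lebesgue

section Product

variable {Ω ι κ : Type*} [MeasurableSpace Ω] [Fintype ι] [Fintype κ]

theorem lintegral_prod_pi {α : ι → Type*} [∀ i, MeasurableSpace (α i)] (μ : ∀ i, Measure (α i))
    [∀ i, IsProbabilityMeasure (μ i)] {u : ∀ i, α i → ℝ≥0∞} (hu : ∀ i, Measurable (u i)) :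
    ∫⁻ ω, ∏ i, u i (ω i) ∂(Measure.pi μ) = ∏ i, ∫⁻ x, u i x ∂(μ i) := by
  rw [lintegral_prod_eq_prod_lintegral_of_indepFun Finset.univ _
    (iIndepFun_pi fun i => (hu i).aemeasurable) fun i => (hu i).comp (measurable_pi_apply i)]
  exact Finset.prod_congr rfl fun i _ => (measurePreserving_eval μ i).lintegral_comp (hu i)

theorem eLpNorm_prod_pi (μ : Measure Ω) [IsProbabilityMeasure μ] {p : ℝ≥0∞} (hp : p ≠ 0)
    (hp' : p ≠ ∞) {u : Ω → ℝ≥0∞} (hu : Measurable u) :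
    eLpNorm (fun ω : ι → Ω => ∏ i, u (ω i)) p (Measure.pi fun _ => μ) =
      eLpNorm u p μ ^ Fintype.card ι := by
  have hp0 : 0 ≤ p.toReal := ENNReal.toReal_nonneg
  simp only [eLpNorm_eq_lintegral_rpow hp hp', ← ENNReal.prod_rpow_of_nonneg hp0]
  rw [lintegral_prod_pi _ fun _ => hu.pow_const _, Finset.prod_const, Finset.card_univ,
    ← ENNReal.rpow_natCast, ← ENNReal.rpow_natCast, ← ENNReal.rpow_mul, ← ENNReal.rpow_mul,
    mul_comm]

theorem measurePreserving_pi_comp (μ : Measure Ω) [IsProbabilityMeasure μ] {e : ι → κ}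
    (he : Function.Injective e) :
    MeasurePreserving (fun (ω : κ → Ω) i => ω (e i)) (Measure.pi fun _ => μ)
      (Measure.pi fun _ => μ) := by
  have hindep : iIndepFun (fun (j : κ) (ω : κ → Ω) => ω j) (Measure.pi fun _ => μ) :=
    iIndepFun_pi (X := fun _ => id) fun _ => aemeasurable_id
  refine ⟨by fun_prop, ?_⟩
  rw [(iIndepFun_iff_map_fun_eq_pi_map fun i => (measurable_pi_apply (e i)).aemeasurable).1
    (hindep.precomp he)]
  exact congrArg Measure.pi
    (funext fun i => (measurePreserving_eval (fun _ : κ => μ) (e i)).map_eq)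

theorem measurePreserving_pi_curry (μ : Measure Ω) [IsProbabilityMeasure μ] :
    MeasurePreserving (MeasurableEquiv.curry ι κ Ω) (Measure.pi fun _ => μ)
      (Measure.pi fun _ => Measure.pi fun _ => μ) := by
  refine ⟨MeasurableEquiv.measurable _, ?_⟩
  simpa only [Measure.infinitePi_eq_pi] using
    Measure.infinitePi_map_curry fun (_ : ι) (_ : κ) => μ

theorem exists_finset_forall_prod_mem {α M : Type*} [CommMonoid M] {R : Finset M} {f : α → M}
    (hf : ∀ a, f a ∈ R) (ι : Type*) [Fintype ι] :
    ∃ S : Finset M, S.card ≤ (Fintype.card ι + 1) ^ R.card ∧ ∀ x : ι → α, ∏ i, f (x i) ∈ S := by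
  classical
  refine ⟨Finset.univ.image fun c : R → Fin (Fintype.card ι + 1) => ∏ v : R, (v : M) ^ (c v : ℕ),
    Finset.card_image_le.trans (by simp), fun x => ?_⟩
  let count (v : M) : ℕ := (Finset.univ.filter fun i => f (x i) = v).card
  have hcount (v : M) : count v < Fintype.card ι + 1 := Nat.lt_succ_of_le (Finset.card_le_univ _)
  have hprod : ∏ v : R, (v : M) ^ count v = ∏ i, f (x i) := by
    rw [Finset.prod_coe_sort R fun v => v ^ count v]
    simp only [count, ← Finset.prod_const]
    exact (Finset.prod_fiberwise_of_maps_to' (fun i _ => hf (x i)) id)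
  exact Finset.mem_image.2 ⟨fun v => ⟨count v, hcount v⟩, Finset.mem_univ _, hprod⟩

end Product

theorem le_of_forall_pow_le {a b : ℝ≥0∞} {M : ℕ}
    (h : ∀ k : ℕ, a ^ k ≤ ((k + 1) ^ M : ℕ) * b ^ k) : a ≤ b := by
  have hroot : ∀ᶠ k : ℕ in atTop, a ≤ ENNReal.ofReal (((k : ℝ) + 1) ^ ((M : ℝ) / k)) * b := by
    filter_upwards [eventually_gt_atTop 0] with k hk
    have hk' : (0 : ℝ) < k := Nat.cast_pos.2 hk
    rw [← ENNReal.rpow_le_rpow_iff hk', ENNReal.mul_rpow_of_nonneg _ _ hk'.le,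
      ENNReal.ofReal_rpow_of_nonneg (by positivity) hk'.le, ← Real.rpow_mul (by positivity),
      div_mul_cancel₀ _ hk'.ne']
    simp only [ENNReal.rpow_natCast, Real.rpow_natCast]
    refine (h k).trans (le_of_eq ?_)
    congr 1
    rw [← ENNReal.ofReal_natCast]
    push_cast
    rfl
  have hlim : Tendsto (fun k : ℕ => ((k : ℝ) + 1) ^ ((M : ℝ) / k)) atTop (𝓝 1) := by
    have := (tendsto_rpow_div_mul_add M 1 (-1) zero_ne_one).comp
      (tendsto_atTop_add_const_right _ 1 (tendsto_natCast_atTop_atTop (R := ℝ)))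
    simpa [Function.comp_def] using this
  have hlim' := ENNReal.Tendsto.mul_const (b := b) (ENNReal.tendsto_ofReal hlim) (by simp)
  rw [ENNReal.ofReal_one, one_mul] at hlim'
  exact ge_of_tendsto hlim' hroot

section Bilinear

variable {Ω 𝒳 𝒴 Ω' 𝒳' 𝒴' : Type*} [MeasurableSpace Ω] [MeasurableSpace 𝒳] [MeasurableSpace 𝒴]
  [MeasurableSpace Ω'] [MeasurableSpace 𝒳'] [MeasurableSpace 𝒴']
  {X : Ω → 𝒳} {Y : Ω → 𝒴} {μ : Measure Ω} {X' : Ω' → 𝒳'} {Y' : Ω' → 𝒴'} {ν : Measure Ω'}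
  {p q : ℝ≥0∞}

/-- The bilinear form of hypercontractivity, `E[f(X) g(Y)] ≤ ‖f(X)‖_p ‖g(Y)‖_q` for all nonnegative
measurable `f` and `g`. -/
def BilinearBound (X : Ω → 𝒳) (Y : Ω → 𝒴) (μ : Measure Ω) (p q : ℝ≥0∞) : Prop :=
  ∀ (f : 𝒳 → ℝ≥0∞) (g : 𝒴 → ℝ≥0∞), Measurable f → Measurable g →
    ∫⁻ ω, f (X ω) * g (Y ω) ∂μ ≤
      eLpNorm (fun ω => f (X ω)) p μ * eLpNorm (fun ω => g (Y ω)) q μ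

theorem iSup_eapprox_mul_eapprox {f : 𝒳 → ℝ≥0∞} {g : 𝒴 → ℝ≥0∞} (hf : Measurable f)
    (hg : Measurable g) (x : 𝒳) (y : 𝒴) :
    ⨆ n, SimpleFunc.eapprox f n x * SimpleFunc.eapprox g n y = f x * g y := by
  rw [← SimpleFunc.iSup_eapprox_apply hf, ← SimpleFunc.iSup_eapprox_apply hg]
  refine le_antisymm ENNReal.iSup_mul_le ?_
  simp_rw [ENNReal.iSup_mul, ENNReal.mul_iSup]
  exact iSup_le fun i => iSup_le fun j => le_iSup_of_le (max i j) <|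
    mul_le_mul' (SimpleFunc.monotone_eapprox f (le_max_left i j) x)
      (SimpleFunc.monotone_eapprox g (le_max_right i j) y)

theorem BilinearBound.of_simpleFunc (hX : Measurable X) (hY : Measurable Y)
    (h : ∀ (f : SimpleFunc 𝒳 ℝ≥0∞) (g : SimpleFunc 𝒴 ℝ≥0∞), (∀ x, f x < ∞) → (∀ y, g y < ∞) →
      ∫⁻ ω, f (X ω) * g (Y ω) ∂μ ≤
        eLpNorm (fun ω => f (X ω)) p μ * eLpNorm (fun ω => g (Y ω)) q μ) :
    BilinearBound X Y μ p q := by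
  intro f g hf hg
  have hmeas (n : ℕ) : Measurable fun ω =>
      SimpleFunc.eapprox f n (X ω) * SimpleFunc.eapprox g n (Y ω) :=
    ((SimpleFunc.measurable _).comp hX).mul ((SimpleFunc.measurable _).comp hY)
  have hmono : Monotone fun n ω =>
      SimpleFunc.eapprox f n (X ω) * SimpleFunc.eapprox g n (Y ω) := fun i j hij ω =>
    mul_le_mul' (SimpleFunc.monotone_eapprox f hij _) (SimpleFunc.monotone_eapprox g hij _)
  simp_rw [← iSup_eapprox_mul_eapprox hf hg]
  rw [lintegral_iSup hmeas hmono]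
  refine iSup_le fun n => (h _ _ (SimpleFunc.eapprox_lt_top f n)
    (SimpleFunc.eapprox_lt_top g n)).trans ?_
  gcongr <;> refine eLpNorm_mono_enorm fun ω => ?_
  · exact (le_iSup _ n).trans (SimpleFunc.iSup_eapprox_apply hf _).le
  · exact (le_iSup _ n).trans (SimpleFunc.iSup_eapprox_apply hg _).le

theorem bilinearBound_two (hX : Measurable X) (hY : Measurable Y) : BilinearBound X Y μ 2 2 := by
  intro f g hf hg
  simpa only [eLpNorm_eq_lintegral_rpow two_ne_zero ENNReal.ofNat_ne_top, ENNReal.toReal_ofNat,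
      Pi.mul_apply, Function.comp_apply]
    using ENNReal.lintegral_mul_le_Lp_mul_Lq μ Real.HolderConjugate.two_two
      (hf.comp hX).aemeasurable (hg.comp hY).aemeasurable

theorem BilinearBound.of_measurePreserving (hX : Measurable X) (hY : Measurable Y)
    {T : Ω' → Ω} (hT : MeasurePreserving T ν μ) {φ : 𝒳 → 𝒳'} {ψ : 𝒴 → 𝒴'} (hφ : Measurable φ)
    (hψ : Measurable ψ) (hφX : ∀ ω, X' ω = φ (X (T ω))) (hψY : ∀ ω, Y' ω = ψ (Y (T ω)))
    (h : BilinearBound X Y μ p q) : BilinearBound X' Y' ν p q := by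
  intro f g hf hg
  have hfX : Measurable fun ω => f (φ (X ω)) := hf.comp (hφ.comp hX)
  have hgY : Measurable fun ω => g (ψ (Y ω)) := hg.comp (hψ.comp hY)
  simp only [hφX, hψY]
  calc ∫⁻ ω, f (φ (X (T ω))) * g (ψ (Y (T ω))) ∂ν
      = ∫⁻ ω, f (φ (X ω)) * g (ψ (Y ω)) ∂μ := hT.lintegral_comp (hfX.mul hgY)
    _ ≤ eLpNorm (fun ω => f (φ (X ω))) p μ * eLpNorm (fun ω => g (ψ (Y ω))) q μ :=
        h (fun x => f (φ x)) (fun y => g (ψ y)) (hf.comp hφ) (hg.comp hψ)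
    _ = eLpNorm (fun ω => f (φ (X (T ω)))) p ν * eLpNorm (fun ω => g (ψ (Y (T ω)))) q ν :=
        (congrArg₂ (· * ·) (eLpNorm_comp_measurePreserving hfX.aestronglyMeasurable hT)
          (eLpNorm_comp_measurePreserving hgY.aestronglyMeasurable hT)).symm

theorem BilinearBound.prod [SFinite ν] (hp : p ≠ 0) (hp' : p ≠ ∞) (hq : q ≠ 0)
    (hq' : q ≠ ∞) (hX : Measurable X) (hY : Measurable Y) (hX' : Measurable X')
    (hY' : Measurable Y') (h : BilinearBound X Y μ p q) (h' : BilinearBound X' Y' ν p q) :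
    BilinearBound (Prod.map X X') (Prod.map Y Y') (μ.prod ν) p q := by
  intro f g hf hg
  have hfX : Measurable fun z : Ω × Ω' => f (Prod.map X X' z) := hf.comp (hX.prodMap hX')
  have hgY : Measurable fun z : Ω × Ω' => g (Prod.map Y Y' z) := hg.comp (hY.prodMap hY')
  have hF : Measurable fun x => eLpNorm (fun ω' => f (x, X' ω')) p ν :=
    measurable_eLpNorm_prodMk (u := fun z : 𝒳 × Ω' => f (z.1, X' z.2)) hp hp' (by fun_prop)
  have hG : Measurable fun y => eLpNorm (fun ω' => g (y, Y' ω')) q ν :=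
    measurable_eLpNorm_prodMk (u := fun z : 𝒴 × Ω' => g (z.1, Y' z.2)) hq hq' (by fun_prop)
  have hinner (x : 𝒳) (y : 𝒴) : ∫⁻ ω', f (x, X' ω') * g (y, Y' ω') ∂ν ≤
      eLpNorm (fun ω' => f (x, X' ω')) p ν * eLpNorm (fun ω' => g (y, Y' ω')) q ν :=
    h' (fun x' => f (x, x')) (fun y' => g (y, y')) (by fun_prop) (by fun_prop)
  rw [eLpNorm_prod hp hp' hfX, eLpNorm_prod hq hq' hgY, lintegral_prod _ (by fun_prop)]
  exact (lintegral_mono fun ω => hinner (X ω) (Y ω)).trans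
    (h (fun x => eLpNorm (fun ω' => f (x, X' ω')) p ν)
      (fun y => eLpNorm (fun ω' => g (y, Y' ω')) q ν) hF hG)

/-- Apply `X` to every coordinate; on a power of the probability space this turns `X` into a vector
of independent copies of itself. -/
def coordwise {ι : Type*} (X : Ω → 𝒳) (ω : ι → Ω) : ι → 𝒳 := fun i => X (ω i)

theorem measurable_coordwise {ι : Type*} (hX : Measurable X) :
    Measurable (coordwise (ι := ι) X) :=
  measurable_pi_lambda _ fun i => hX.comp (measurable_pi_apply i)

theorem BilinearBound.pi [IsProbabilityMeasure μ] (hp : p ≠ 0) (hp' : p ≠ ∞) (hq : q ≠ 0)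
    (hq' : q ≠ ∞) (hX : Measurable X) (hY : Measurable Y) (h : BilinearBound X Y μ p q) (n : ℕ) :
    BilinearBound (coordwise X) (coordwise Y) (Measure.pi fun _ : Fin n => μ) p q := by
  induction n with
  | zero =>
    intro f g _ _
    have hX0 (ω : Fin 0 → Ω) : coordwise X ω = Fin.elim0 := Subsingleton.elim _ _
    have hY0 (ω : Fin 0 → Ω) : coordwise Y ω = Fin.elim0 := Subsingleton.elim _ _
    simp only [hX0, hY0, lintegral_const, eLpNorm_const' _ hp hp', eLpNorm_const' _ hq hq',
      measure_univ, ENNReal.one_rpow, mul_one, enorm_eq_self, le_refl]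
  | succ n ih =>
    have hprod := h.prod hp hp' hq hq' hX hY (measurable_coordwise hX) (measurable_coordwise hY) ih
    exact hprod.of_measurePreserving (hX.prodMap (measurable_coordwise hX))
      (hY.prodMap (measurable_coordwise hY))
      (measurePreserving_piFinSuccAbove (fun _ : Fin (n + 1) => μ) 0)
      (MeasurableEquiv.piFinSuccAbove (fun _ => 𝒳) 0).symm.measurable
      (MeasurableEquiv.piFinSuccAbove (fun _ => 𝒴) 0).symm.measurable
      (fun ω => ((MeasurableEquiv.piFinSuccAbove (fun _ => 𝒳) 0).symm_apply_apply _).symm)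
      (fun ω => ((MeasurableEquiv.piFinSuccAbove (fun _ => 𝒴) 0).symm_apply_apply _).symm)

end Bilinear

section Ribbon

variable {Ω 𝒳 𝒴 : Type*} [MeasurableSpace Ω] [MeasurableSpace 𝒳] [MeasurableSpace 𝒴]
  {X : Ω → 𝒳} {Y : Ω → 𝒴} {μ : Measure Ω} {p r s : ℝ≥0∞}

theorem momentNorm_coe_ennreal {Z : Ω → ℝ} (hr : r ≠ 0) :
    momentNorm Z (r : EReal) μ = eLpNorm Z r μ := by
  have hbot : (r : EReal) ≠ ⊥ := EReal.coe_ennreal_ne_bot r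
  rcases eq_or_ne r ∞ with rfl | hr'
  · rw [momentNorm, EReal.coe_ennreal_top, if_pos rfl, eLpNorm_exponent_top, eLpNormEssSup]
  · rw [momentNorm, if_neg (EReal.coe_ennreal_eq_top_iff.not.2 hr'), if_neg hbot,
      if_neg (EReal.coe_ennreal_eq_zero.not.2 hr), EReal.toReal_coe_ennreal,
      eLpNorm_eq_lintegral_rpow_enorm_toReal hr hr']

theorem mem_ribbon_iff (hr : 1 < r) :
    ((r : EReal), (s : EReal)) ∈ ribbon X Y μ ↔ 1 ≤ s ∧ s ≤ r ∧
      ∀ g : 𝒴 → ℝ, Measurable g → Integrable (fun ω => g (Y ω)) μ →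
        eLpNorm (condExpGiven X Y μ g) r μ ≤ eLpNorm (fun ω => g (Y ω)) s μ := by
  have hone : (1 : EReal) = ((1 : ℝ≥0∞) : EReal) := EReal.coe_ennreal_one.symm
  simp only [ribbon, Set.mem_ofPred_eq, momentNorm_coe_ennreal (zero_lt_one.trans hr).ne', hone,
    EReal.coe_ennreal_le_coe_ennreal_iff]
  refine ⟨fun h => ?_, fun h => Or.inl ⟨h.1, h.2.1, ?_⟩⟩
  · obtain ⟨hs, hsr, h⟩ := h.resolve_right fun h => (h.2.1.trans h.1).not_gt hr
    simp only [momentNorm_coe_ennreal (zero_lt_one.trans_le hs).ne'] at h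
    exact ⟨hs, hsr, h⟩
  · simpa only [momentNorm_coe_ennreal (zero_lt_one.trans_le h.1).ne'] using h.2.2

theorem lintegral_enorm_mul_enorm_le {φ ψ : Ω → ℝ} (hφ : AEStronglyMeasurable φ μ)
    (hψ : AEStronglyMeasurable ψ μ) [r.HolderConjugate p] :
    ∫⁻ ω, ‖φ ω‖ₑ * ‖ψ ω‖ₑ ∂μ ≤ eLpNorm φ r μ * eLpNorm ψ p μ := by
  simpa only [eLpNorm_one_eq_lintegral_enorm, smul_eq_mul, Pi.mul_apply, enorm_mul] using
    eLpNorm_smul_le_mul_eLpNorm (p := r) (q := p) (r := 1) hψ hφ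

theorem integrable_toReal_simpleFunc_comp [IsFiniteMeasure μ] (hY : Measurable Y)
    (g : SimpleFunc 𝒴 ℝ≥0∞) : Integrable (fun ω => (g (Y ω)).toReal) μ := by
  obtain ⟨C, hC⟩ := (g.map ENNReal.toReal).exists_forall_norm_le
  exact Integrable.of_bound (g.measurable.comp hY).ennreal_toReal.aestronglyMeasurable C
    (ae_of_all _ fun ω => hC (Y ω))

theorem bilinearBound_of_mem_ribbon [IsFiniteMeasure μ] (hX : Measurable X) (hY : Measurable Y)
    [r.HolderConjugate p] (hr : 1 < r) (h : ((r : EReal), (s : EReal)) ∈ ribbon X Y μ) :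
    BilinearBound X Y μ p s := by
  obtain ⟨-, -, hcontr⟩ := (mem_ribbon_iff hr).1 h
  refine BilinearBound.of_simpleFunc hX hY fun f g hf hg => ?_
  have hgY := integrable_toReal_simpleFunc_comp (μ := μ) hY g
  have hfX := integrable_toReal_simpleFunc_comp (μ := μ) hX f
  have hf_eq (ω : Ω) : ‖(f (X ω)).toReal‖ₑ = f (X ω) := Real.enorm_toReal (hf _).ne
  have hg_eq (ω : Ω) : ‖(g (Y ω)).toReal‖ₑ = g (Y ω) := Real.enorm_toReal (hg _).ne
  have hfnorm : eLpNorm (fun ω => (f (X ω)).toReal) p μ = eLpNorm (fun ω => f (X ω)) p μ :=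
    eLpNorm_congr_enorm_ae (ae_of_all _ hf_eq)
  have hgnorm : eLpNorm (fun ω => (g (Y ω)).toReal) s μ = eLpNorm (fun ω => g (Y ω)) s μ :=
    eLpNorm_congr_enorm_ae (ae_of_all _ hg_eq)
  have hfm : Measurable[MeasurableSpace.comap X inferInstance] fun ω => f (X ω) :=
    f.measurable.comp (comap_measurable X)
  calc ∫⁻ ω, f (X ω) * g (Y ω) ∂μ
      = ∫⁻ ω, ‖(g (Y ω)).toReal‖ₑ * f (X ω) ∂μ := by simp only [hg_eq, mul_comm]
    _ = ∫⁻ ω, ‖condExpGiven X Y μ (fun y => (g y).toReal) ω‖ₑ * f (X ω) ∂μ :=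
        (lintegral_enorm_condExp_mul hX.comap_le hgY (ae_of_all _ fun _ => ENNReal.toReal_nonneg)
          hfm).symm
    _ ≤ eLpNorm (condExpGiven X Y μ fun y => (g y).toReal) r μ *
          eLpNorm (fun ω => (f (X ω)).toReal) p μ := by
        simpa only [hf_eq] using lintegral_enorm_mul_enorm_le
          (φ := condExpGiven X Y μ fun y => (g y).toReal) integrable_condExp.aestronglyMeasurable
          hfX.aestronglyMeasurable
    _ ≤ eLpNorm (fun ω => g (Y ω)) s μ * eLpNorm (fun ω => f (X ω)) p μ := by
        rw [hfnorm, ← hgnorm]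
        gcongr
        exact hcontr _ g.measurable.ennreal_toReal hgY
    _ = _ := mul_comm _ _

theorem BilinearBound.lintegral_enorm_condExpGiven_mul_le [IsFiniteMeasure μ] (hX : Measurable X)
    (h : BilinearBound X Y μ p s) {g : 𝒴 → ℝ} (hg : Measurable g)
    (hint : Integrable (fun ω => g (Y ω)) μ) {f : 𝒳 → ℝ≥0∞} (hf : Measurable f) :
    ∫⁻ ω, f (X ω) * ‖condExpGiven X Y μ g ω‖ₑ ∂μ ≤
      eLpNorm (fun ω => f (X ω)) p μ * eLpNorm (fun ω => g (Y ω)) s μ := by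
  have habs : ∀ᵐ ω ∂μ, ‖condExpGiven X Y μ g ω‖ₑ ≤ ‖condExpGiven X Y μ (fun y => |g y|) ω‖ₑ := by
    filter_upwards [abs_condExp_ae_le_condExp_abs (μ := μ)
      (m := MeasurableSpace.comap X inferInstance) fun ω => g (Y ω)] with ω hω
    exact enorm_le_iff_norm_le.2 (hω.trans (le_abs_self _))
  calc ∫⁻ ω, f (X ω) * ‖condExpGiven X Y μ g ω‖ₑ ∂μ
      ≤ ∫⁻ ω, ‖condExpGiven X Y μ (fun y => |g y|) ω‖ₑ * f (X ω) ∂μ := by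
        refine lintegral_mono_ae ?_
        filter_upwards [habs] with ω hω
        rw [mul_comm]
        gcongr
    _ = ∫⁻ ω, f (X ω) * ‖g (Y ω)‖ₑ ∂μ := by
        have := lintegral_enorm_condExp_mul hX.comap_le hint.abs
          (ae_of_all _ fun _ => abs_nonneg _) (hf.comp (comap_measurable X))
        simpa only [condExpGiven, Real.enorm_abs, Function.comp_apply, mul_comm] using this
    _ ≤ _ := by
        simpa only [eLpNorm_enorm] using h f (fun y => ‖g y‖ₑ) hf hg.enorm

theorem mem_ribbon_of_bilinearBound [IsFiniteMeasure μ] (hX : Measurable X) [r.HolderConjugate p]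
    (hs : 1 ≤ s) (hsr : s ≤ r) (hr : r ≠ ∞) (hp : p ≠ ∞) (h : BilinearBound X Y μ p s) :
    ((r : EReal), (s : EReal)) ∈ ribbon X Y μ := by
  have hr1 : 1 < r := (ENNReal.HolderConjugate.lt_top_iff_one_lt p r).1 hp.lt_top
  have hp1 : 1 < p := (ENNReal.HolderConjugate.lt_top_iff_one_lt r p).1 hr.lt_top
  refine (mem_ribbon_iff hr1).2 ⟨hs, hsr, fun g hg hint => ?_⟩
  obtain ⟨φ, hφ, hφX⟩ : ∃ φ : 𝒳 → ℝ, Measurable φ ∧ condExpGiven X Y μ g = φ ∘ X :=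
    Measurable.exists_eq_measurable_comp (stronglyMeasurable_condExp.measurable)
  have hbound (f : 𝒳 → ℝ≥0∞) (hf : Measurable f) : ∫⁻ x, f x * ‖φ x‖ₑ ∂(μ.map X) ≤
      (∫⁻ x, f x ^ p.toReal ∂(μ.map X)) ^ (1 / p.toReal) * eLpNorm (fun ω => g (Y ω)) s μ := by
    rw [lintegral_map (by fun_prop) hX, lintegral_map (hf.pow_const _) hX,
      ← eLpNorm_eq_lintegral_rpow (zero_lt_one.trans hp1).ne' hp]
    simpa only [hφX, Function.comp_apply] using h.lintegral_enorm_condExpGiven_mul_le hX hg hint hf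
  have hdual := lintegral_rpow_le_of_forall_lintegral_mul_le
    (ENNReal.HolderConjugate.toReal_of_ne_top hp hr) hφ.enorm hbound
  rw [lintegral_map (hφ.enorm.pow_const _) hX] at hdual
  rwa [hφX, eLpNorm_eq_lintegral_rpow_enorm_toReal (zero_lt_one.trans hr1).ne' hr]

end Ribbon

section Rectangle

variable {Ω 𝒳 𝒴 : Type*} [MeasurableSpace Ω] [MeasurableSpace 𝒳] [MeasurableSpace 𝒴]
  {X : Ω → 𝒳} {Y : Ω → 𝒴} {μ : Measure Ω} {QX : Measure 𝒳} {QY : Measure 𝒴} {δ : ℝ≥0}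

/-- The inequality `P_{XY}(A × B)^(1+δ) ≤ Q_X(A) Q_Y(B)` that the wringing dependence asks of the
reference measures `Q_X` and `Q_Y`, for all measurable rectangles. -/
def RectangleBound (X : Ω → 𝒳) (Y : Ω → 𝒴) (μ : Measure Ω) (QX : Measure 𝒳) (QY : Measure 𝒴)
    (δ : ℝ≥0) : Prop :=
  ∀ (A : Set 𝒳) (B : Set 𝒴), MeasurableSet A → MeasurableSet B →
    μ (X ⁻¹' A ∩ Y ⁻¹' B) ^ (1 + (δ : ℝ)) ≤ QX A * QY B

theorem RectangleBound.wringingDependence_le [IsProbabilityMeasure QX] [IsProbabilityMeasure QY]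
    (h : RectangleBound X Y μ QX QY δ) : wringingDependence X Y μ ≤ δ :=
  iInf₂_le_of_le ⟨QX, ‹_›⟩ ⟨QY, ‹_›⟩ <| iSup₂_le fun A hA => iSup₂_le fun B hB =>
    iInf₂_le_of_le δ (h A B hA hB) le_rfl

theorem exists_rectangleBound_of_wringingDependence_lt [IsProbabilityMeasure μ]
    (h : wringingDependence X Y μ < δ) :
    ∃ (QX : ProbabilityMeasure 𝒳) (QY : ProbabilityMeasure 𝒴), RectangleBound X Y μ QX QY δ := by
  simp only [wringingDependence, iInf_lt_iff] at h
  obtain ⟨QX, QY, hsup⟩ := h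
  refine ⟨QX, QY, fun A B hA hB => ?_⟩
  have hinf := (le_iSup₂_of_le A hA (le_iSup₂_of_le B hB le_rfl)).trans_lt hsup
  simp only [iInf_lt_iff] at hinf
  obtain ⟨δ', hδ', hlt⟩ := hinf
  refine (ENNReal.rpow_le_rpow_of_exponent_ge prob_le_one ?_).trans hδ'
  gcongr
  exact_mod_cast hlt.le

theorem toReal_one_add_coe (δ : ℝ≥0) : (1 + (δ : ℝ≥0∞)).toReal = 1 + δ := by
  rw [ENNReal.toReal_add ENNReal.one_ne_top ENNReal.coe_ne_top, ENNReal.toReal_one,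
    ENNReal.coe_toReal]

theorem rectangleBound_map_iff (hX : Measurable X) (hY : Measurable Y) :
    RectangleBound X Y μ (μ.map X) (μ.map Y) δ ↔
      ∀ (A : Set 𝒳) (B : Set 𝒴), MeasurableSet A → MeasurableSet B →
        μ (X ⁻¹' A ∩ Y ⁻¹' B) ≤ μ (X ⁻¹' A) ^ (1 / (1 + (δ : ℝ≥0∞)).toReal) *
          μ (Y ⁻¹' B) ^ (1 / (1 + (δ : ℝ≥0∞)).toReal) := by
  have hδ : (0 : ℝ) < 1 + δ := by positivity
  refine forall₄_congr fun A B hA hB => ?_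
  rw [Measure.map_apply hX hA, Measure.map_apply hY hB, ← ENNReal.le_rpow_inv_iff hδ,
    ENNReal.mul_rpow_of_nonneg _ _ (inv_nonneg.2 hδ.le), ← one_div, toReal_one_add_coe]

theorem BilinearBound.rectangleBound (hX : Measurable X) (hY : Measurable Y)
    (h : BilinearBound X Y μ (1 + δ) (1 + δ)) :
    RectangleBound X Y μ (μ.map X) (μ.map Y) δ := by
  refine (rectangleBound_map_iff hX hY).2 fun A B hA hB => ?_
  have hnorm {E : Set Ω} (hE : MeasurableSet E) :
      eLpNorm (E.indicator fun _ => (1 : ℝ≥0∞)) (1 + δ) μ =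
        μ E ^ (1 / (1 + (δ : ℝ≥0∞)).toReal) := by
    rw [eLpNorm_indicator_const hE (by simp) (by finiteness), enorm_eq_self, one_mul]
  have hinter (ω : Ω) : (X ⁻¹' A ∩ Y ⁻¹' B).indicator (1 : Ω → ℝ≥0∞) ω =
      A.indicator (fun _ => 1) (X ω) * B.indicator (fun _ => 1) (Y ω) :=
    congrFun Set.inter_indicator_one ω
  calc μ (X ⁻¹' A ∩ Y ⁻¹' B)
      = ∫⁻ ω, A.indicator (fun _ => 1) (X ω) * B.indicator (fun _ => 1) (Y ω) ∂μ := by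
        rw [← lintegral_indicator_one ((hX hA).inter (hY hB))]
        exact lintegral_congr hinter
    _ ≤ eLpNorm ((X ⁻¹' A).indicator fun _ => (1 : ℝ≥0∞)) (1 + δ) μ *
          eLpNorm ((Y ⁻¹' B).indicator fun _ => (1 : ℝ≥0∞)) (1 + δ) μ :=
        h (A.indicator fun _ => 1) (B.indicator fun _ => 1) (measurable_const.indicator hA)
          (measurable_const.indicator hB)
    _ = _ := by rw [hnorm (hX hA), hnorm (hY hB)]

theorem RectangleBound.lintegral_mul_le (hX : Measurable X) (hY : Measurable Y)
    (h : RectangleBound X Y μ (μ.map X) (μ.map Y) δ) {f : 𝒳 → ℝ≥0∞} {g : 𝒴 → ℝ≥0∞}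
    (hf : Measurable f) (hg : Measurable g) {S T : Finset ℝ≥0∞}
    (hS : ∀ x, f x ∈ S) (hT : ∀ y, g y ∈ T) :
    ∫⁻ ω, f (X ω) * g (Y ω) ∂μ ≤ (S.card * T.card : ℕ) *
      (eLpNorm (fun ω => f (X ω)) (1 + δ) μ * eLpNorm (fun ω => g (Y ω)) (1 + δ) μ) := by
  have hfX : Measurable fun ω => f (X ω) := hf.comp hX
  have hgY : Measurable fun ω => g (Y ω) := hg.comp hY
  have hlevel (a b : ℝ≥0∞) :
      a * b * μ ((fun ω => f (X ω)) ⁻¹' {a} ∩ (fun ω => g (Y ω)) ⁻¹' {b}) ≤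
        eLpNorm (fun ω => f (X ω)) (1 + δ) μ * eLpNorm (fun ω => g (Y ω)) (1 + δ) μ := by
    have hab := (rectangleBound_map_iff hX hY).1 h (f ⁻¹' {a}) (g ⁻¹' {b})
      (hf (measurableSet_singleton a)) (hg (measurableSet_singleton b))
    calc a * b * μ (X ⁻¹' (f ⁻¹' {a}) ∩ Y ⁻¹' (g ⁻¹' {b}))
        ≤ a * b * _ := mul_le_mul_right hab _
      _ = (a * μ ((fun ω => f (X ω)) ⁻¹' {a}) ^ (1 / (1 + (δ : ℝ≥0∞)).toReal)) *
            (b * μ ((fun ω => g (Y ω)) ⁻¹' {b}) ^ (1 / (1 + (δ : ℝ≥0∞)).toReal)) :=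
          mul_mul_mul_comm _ _ _ _
      _ ≤ _ := mul_le_mul' (mul_measure_rpow_le_eLpNorm hfX (by simp) (by finiteness) a)
          (mul_measure_rpow_le_eLpNorm hgY (by simp) (by finiteness) b)
  rw [lintegral_mul_eq_sum hfX hgY (fun ω => hS (X ω)) fun ω => hT (Y ω), Nat.cast_mul, mul_assoc]
  simp only [← nsmul_eq_mul]
  exact Finset.sum_le_card_nsmul _ _ _ fun a _ => Finset.sum_le_card_nsmul _ _ _ fun b _ =>
    hlevel a b

theorem bilinearBound_of_forall_rectangleBound_pi [IsProbabilityMeasure μ] (hX : Measurable X)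
    (hY : Measurable Y)
    (h : ∀ k : ℕ, RectangleBound (coordwise X) (coordwise Y) (Measure.pi fun _ : Fin k => μ)
      ((Measure.pi fun _ : Fin k => μ).map (coordwise X))
      ((Measure.pi fun _ : Fin k => μ).map (coordwise Y)) δ) :
    BilinearBound X Y μ (1 + δ) (1 + δ) := by
  refine BilinearBound.of_simpleFunc hX hY fun f g _ _ => ?_
  have hfX : Measurable fun ω => f (X ω) := f.measurable.comp hX
  have hgY : Measurable fun ω => g (Y ω) := g.measurable.comp hY
  -- Tensor power trick: a `k`-fold product of simple functions takes polynomially many values.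
  refine le_of_forall_pow_le (M := f.range.card + g.range.card) fun k => ?_
  obtain ⟨S, hScard, hS⟩ := exists_finset_forall_prod_mem f.mem_range_self (Fin k)
  obtain ⟨T, hTcard, hT⟩ := exists_finset_forall_prod_mem g.mem_range_self (Fin k)
  rw [Fintype.card_fin] at hScard hTcard
  calc (∫⁻ ω, f (X ω) * g (Y ω) ∂μ) ^ k
      = ∫⁻ ω : Fin k → Ω, (∏ i, f (X (ω i))) * ∏ i, g (Y (ω i)) ∂(Measure.pi fun _ => μ) := by
        simp_rw [← Finset.prod_mul_distrib]
        rw [lintegral_prod_pi (fun _ => μ) (u := fun _ ω => f (X ω) * g (Y ω))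
          fun _ => hfX.mul hgY, Finset.prod_const, Finset.card_univ, Fintype.card_fin]
    _ ≤ (S.card * T.card : ℕ) *
          (eLpNorm (fun ω : Fin k → Ω => ∏ i, f (X (ω i))) (1 + δ) (Measure.pi fun _ => μ) *
            eLpNorm (fun ω : Fin k → Ω => ∏ i, g (Y (ω i))) (1 + δ) (Measure.pi fun _ => μ)) :=
        (h k).lintegral_mul_le (f := fun x => ∏ i, f (x i)) (g := fun y => ∏ i, g (y i))
          (measurable_coordwise hX) (measurable_coordwise hY) (by fun_prop) (by fun_prop) hS hT
    _ = (S.card * T.card : ℕ) * (eLpNorm (fun ω => f (X ω)) (1 + δ) μ *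
          eLpNorm (fun ω => g (Y ω)) (1 + δ) μ) ^ k := by
        rw [eLpNorm_prod_pi μ (by simp) (by finiteness) hfX,
          eLpNorm_prod_pi μ (by simp) (by finiteness) hgY, Fintype.card_fin, mul_pow]
    _ ≤ _ := by
        rw [pow_add]
        gcongr

end Rectangle

section Averaging

theorem le_mul_of_forall_le_mul {ι : Type*} [Fintype ι] [Nonempty ι] {a b : ι → ℝ}
    (ha : ∀ i, 0 ≤ a i) (hb : ∀ i, 0 ≤ b i) {K α β : ℝ} (hK : 0 ≤ K)
    (h : ∀ i, K ≤ a i * b i) (hα : ∑ i, a i ≤ Fintype.card ι * α)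
    (hβ : ∑ i, b i ≤ Fintype.card ι * β) : K ≤ α * β := by
  have hm : (0 : ℝ) < Fintype.card ι := Nat.cast_pos.2 Fintype.card_pos
  have hcs := Finset.sum_sq_le_sum_mul_sum_of_sq_le_mul Finset.univ (r := fun _ : ι => √K)
    (fun i _ => ha i) (fun i _ => hb i) (fun i _ => (Real.sq_sqrt hK).trans_le (h i))
  rw [Finset.sum_const, Finset.card_univ, nsmul_eq_mul, mul_pow, Real.sq_sqrt hK] at hcs
  refine le_of_mul_le_mul_left ?_ (pow_pos hm 2)
  calc (Fintype.card ι : ℝ) ^ 2 * K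
      ≤ (∑ i, a i) * ∑ i, b i := hcs
    _ ≤ (Fintype.card ι * α) * (Fintype.card ι * β) :=
        mul_le_mul hα hβ (Finset.sum_nonneg fun i _ => hb i)
          ((Finset.sum_nonneg fun i _ => ha i).trans hα)
    _ = (Fintype.card ι : ℝ) ^ 2 * (α * β) := by ring

end Averaging

section Hits

variable {Ω ι : Type*} [Fintype ι] {E F : Set Ω}

/-- The number of coordinates of `ω` that lie in `E`. -/
noncomputable def hits (E : Set Ω) (ω : ι → Ω) : ℝ := ∑ i, E.indicator 1 (ω i)

/-- The vectors that lie in `E` at coordinate `i` but have fewer than `c` coordinates in `E`; for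
`c` slightly above the expected number of hits these are the typical ones among the vectors with
`ω i ∈ E`. -/
def hitAt (E : Set Ω) (c : ℝ) (i : ι) : Set (ι → Ω) := {ω | ω i ∈ E ∧ hits E ω < c}

theorem sum_indicator_hitAt_le {c : ℝ} (hc : 0 ≤ c) (ω : ι → Ω) :
    ∑ i, (hitAt E c i).indicator (1 : (ι → Ω) → ℝ) ω ≤ c := by
  by_cases hω : hits E ω < c
  · have hterm (i : ι) : (hitAt E c i).indicator (1 : (ι → Ω) → ℝ) ω = E.indicator 1 (ω i) := by
      by_cases hi : ω i ∈ E <;> simp [hitAt, hi, hω]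
    simp_rw [hterm]
    exact hω.le
  · simpa [hitAt, hω] using hc

variable [MeasurableSpace Ω]

theorem measurable_hits (hE : MeasurableSet E) : Measurable (hits (ι := ι) E) :=
  Finset.measurable_fun_sum _ fun i _ => (measurable_one.indicator hE).comp (measurable_pi_apply i)

theorem measurableSet_hitAt (hE : MeasurableSet E) (c : ℝ) (i : ι) :
    MeasurableSet (hitAt E c i) :=
  (measurable_pi_apply i hE).inter (measurable_hits hE measurableSet_Iio)

theorem sum_measureReal_hitAt_le (hE : MeasurableSet E) {c : ℝ} (hc : 0 ≤ c)
    (Q : Measure (ι → Ω)) [IsProbabilityMeasure Q] : ∑ i, Q.real (hitAt E c i) ≤ c := by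
  have hint (i : ι) : Integrable ((hitAt E c i).indicator (1 : (ι → Ω) → ℝ)) Q :=
    (integrable_const 1).indicator (measurableSet_hitAt hE c i)
  calc ∑ i, Q.real (hitAt E c i)
      = ∫ ω, ∑ i, (hitAt E c i).indicator (1 : (ι → Ω) → ℝ) ω ∂Q := by
        rw [integral_finsetSum _ fun i _ => hint i]
        simp_rw [integral_indicator_one (measurableSet_hitAt hE c _)]
    _ ≤ ∫ _, c ∂Q := integral_mono (integrable_finsetSum _ fun i _ => hint i) (integrable_const c)
        fun ω => sum_indicator_hitAt_le hc ω
    _ = c := by simp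

theorem hasSubgaussianMGF_indicator_sub (μ : Measure Ω) [IsProbabilityMeasure μ]
    (hE : MeasurableSet E) :
    HasSubgaussianMGF (fun ω => E.indicator 1 ω - μ.real E) (1 / 4) μ := by
  have hIcc (ω : Ω) : E.indicator (1 : Ω → ℝ) ω ∈ Set.Icc 0 1 := by
    by_cases hω : ω ∈ E <;> simp [hω]
  have hvar : (‖(1 : ℝ) - 0‖₊ / 2) ^ 2 = 1 / 4 := by norm_num
  have hsubG := hasSubgaussianMGF_of_mem_Icc (μ := μ) (measurable_one.indicator hE).aemeasurable
    (ae_of_all _ hIcc)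
  rwa [integral_indicator_one hE, hvar] at hsubG

theorem measureReal_pi_le_hits_le (μ : Measure Ω) [IsProbabilityMeasure μ] (hE : MeasurableSet E)
    {η : ℝ} (hη : 0 ≤ η) :
    (Measure.pi fun _ : ι => μ).real {ω | Fintype.card ι * (μ.real E + η) ≤ hits E ω} ≤
      Real.exp (-2 * η ^ 2 * Fintype.card ι) := by
  have hsubG (i : ι) : HasSubgaussianMGF (fun ω : ι → Ω => E.indicator 1 (ω i) - μ.real E) (1 / 4)
      (Measure.pi fun _ => μ) := by
    have heval := measurePreserving_eval (fun _ : ι => μ) i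
    rw [← heval.measureReal_preimage hE.nullMeasurableSet]
    exact hasSubgaussianMGF_indicator_sub _ (heval.measurable hE)
  have hindep : iIndepFun (fun (i : ι) (ω : ι → Ω) => E.indicator 1 (ω i) - μ.real E)
      (Measure.pi fun _ => μ) :=
    iIndepFun_pi (X := fun _ ω => E.indicator 1 ω - μ.real E) fun _ =>
      ((measurable_one.indicator hE).sub_const _).aemeasurable
  have hset : {ω : ι → Ω | Fintype.card ι * (μ.real E + η) ≤ hits E ω} =
      {ω | Fintype.card ι * η ≤ ∑ i, (E.indicator 1 (ω i) - μ.real E)} := by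
    ext ω
    simp only [Set.mem_ofPred_eq, hits, Finset.sum_sub_distrib, Finset.sum_const, Finset.card_univ,
      nsmul_eq_mul, mul_add, le_sub_iff_add_le']
  rw [hset]
  refine (HasSubgaussianMGF.measure_sum_ge_le_of_iIndepFun hindep (fun i _ => hsubG i)
    (by positivity)).trans (Real.exp_le_exp.2 (le_of_eq ?_))
  rcases isEmpty_or_nonempty ι with _ | _
  · simp
  · have hm : (Fintype.card ι : ℝ) ≠ 0 := Nat.cast_ne_zero.2 Fintype.card_ne_zero
    simp only [Finset.sum_const, Finset.card_univ, nsmul_eq_mul, NNReal.coe_mul,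
      NNReal.coe_natCast, NNReal.coe_div, NNReal.coe_one, NNReal.coe_ofNat]
    field_simp
    norm_num

theorem le_measureReal_hitAt_inter_hitAt (μ : Measure Ω) [IsProbabilityMeasure μ]
    (hE : MeasurableSet E) (hF : MeasurableSet F) {η : ℝ} (hη : 0 ≤ η) (i : ι) :
    μ.real (E ∩ F) - 2 * Real.exp (-2 * η ^ 2 * Fintype.card ι) ≤
      (Measure.pi fun _ : ι => μ).real (hitAt E (Fintype.card ι * (μ.real E + η)) i ∩
        hitAt F (Fintype.card ι * (μ.real F + η)) i) := by
  have heval : (Measure.pi fun _ : ι => μ).real (Function.eval i ⁻¹' (E ∩ F)) = μ.real (E ∩ F) :=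
    (measurePreserving_eval (fun _ : ι => μ) i).measureReal_preimage
      (hE.inter hF).nullMeasurableSet
  have hcover : (Function.eval i ⁻¹' (E ∩ F) : Set (ι → Ω)) ⊆
      (hitAt E (Fintype.card ι * (μ.real E + η)) i ∩ hitAt F (Fintype.card ι * (μ.real F + η)) i) ∪
        ({ω | Fintype.card ι * (μ.real E + η) ≤ hits E ω} ∪
          {ω | Fintype.card ι * (μ.real F + η) ≤ hits F ω}) := by
    intro ω hω
    by_cases hωE : Fintype.card ι * (μ.real E + η) ≤ hits E ω
    · exact Or.inr (Or.inl hωE)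
    by_cases hωF : Fintype.card ι * (μ.real F + η) ≤ hits F ω
    · exact Or.inr (Or.inr hωF)
    exact Or.inl ⟨⟨hω.1, not_le.1 hωE⟩, ⟨hω.2, not_le.1 hωF⟩⟩
  have hunion := (measureReal_mono (μ := Measure.pi fun _ : ι => μ) hcover).trans <|
    (measureReal_union_le _ _).trans (add_le_add_right (measureReal_union_le _ _) _)
  have hexpE := measureReal_pi_le_hits_le (ι := ι) μ hE hη
  have hexpF := measureReal_pi_le_hits_le (ι := ι) μ hF hη
  linarith

end Hits

section SingleLetter

variable {Ω 𝒳 𝒴 ι : Type*} [MeasurableSpace Ω] [MeasurableSpace 𝒳] [MeasurableSpace 𝒴] [Fintype ι]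
  {X : Ω → 𝒳} {Y : Ω → 𝒴} {μ : Measure Ω} [IsProbabilityMeasure μ] {δ : ℝ≥0}

theorem RectangleBound.rpow_sub_exp_le [Nonempty ι] (hX : Measurable X) (hY : Measurable Y)
    {QX : Measure (ι → 𝒳)} {QY : Measure (ι → 𝒴)}
    [IsProbabilityMeasure QX] [IsProbabilityMeasure QY]
    (h : RectangleBound (coordwise X) (coordwise Y) (Measure.pi fun _ : ι => μ) QX QY δ)
    {A : Set 𝒳} {B : Set 𝒴} (hA : MeasurableSet A) (hB : MeasurableSet B) {η : ℝ} (hη : 0 ≤ η) :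
    (max 0 (μ.real (X ⁻¹' A ∩ Y ⁻¹' B) - 2 * Real.exp (-2 * η ^ 2 * Fintype.card ι))) ^
        (1 + (δ : ℝ)) ≤ (μ.real (X ⁻¹' A) + η) * (μ.real (Y ⁻¹' B) + η) := by
  have hrect (i : ι) := ENNReal.toReal_mono (by finiteness) <|
    h _ _ (measurableSet_hitAt hA (Fintype.card ι * (μ.real (X ⁻¹' A) + η)) i)
      (measurableSet_hitAt hB (Fintype.card ι * (μ.real (Y ⁻¹' B) + η)) i)
  simp only [ENNReal.toReal_mul, ← ENNReal.toReal_rpow] at hrect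
  have hjoint (i : ι) := max_le measureReal_nonneg
    (le_measureReal_hitAt_inter_hitAt μ (hX hA) (hY hB) hη i)
  -- The reference measures are arbitrary, but on average over `i` they give `hitAt` little mass.
  exact le_mul_of_forall_le_mul (fun _ => measureReal_nonneg) (fun _ => measureReal_nonneg)
    (by positivity)
    (fun i => (Real.rpow_le_rpow (le_max_left _ _) (hjoint i) (by positivity)).trans (hrect i))
    (sum_measureReal_hitAt_le hA (by positivity) QX)
    (sum_measureReal_hitAt_le hB (by positivity) QY)

theorem rectangleBound_map_of_forall_pi (hX : Measurable X) (hY : Measurable Y)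
    (h : ∀ m : ℕ, ∃ (QX : ProbabilityMeasure (Fin m → 𝒳)) (QY : ProbabilityMeasure (Fin m → 𝒴)),
      RectangleBound (coordwise X) (coordwise Y) (Measure.pi fun _ : Fin m => μ) QX QY δ) :
    RectangleBound X Y μ (μ.map X) (μ.map Y) δ := by
  intro A B hA hB
  have hδ : (0 : ℝ) < 1 + δ := by positivity
  have happrox (η : ℝ) (hη : 0 < η) : μ.real (X ⁻¹' A ∩ Y ⁻¹' B) ^ (1 + (δ : ℝ)) ≤
      (μ.real (X ⁻¹' A) + η) * (μ.real (Y ⁻¹' B) + η) := by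
    have hexp : Tendsto (fun m : ℕ => Real.exp (-2 * η ^ 2 * m)) atTop (𝓝 0) :=
      Real.tendsto_exp_atBot.comp
        (tendsto_natCast_atTop_atTop.const_mul_atTop_of_neg (by nlinarith [sq_pos_of_pos hη]))
    have hlim := ((tendsto_const_nhds (x := (0 : ℝ))).max
      ((hexp.const_mul 2).const_sub (μ.real (X ⁻¹' A ∩ Y ⁻¹' B)))).rpow_const
        (p := 1 + (δ : ℝ)) (Or.inr hδ.le)
    rw [mul_zero, sub_zero, max_eq_right measureReal_nonneg] at hlim
    refine le_of_tendsto hlim ?_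
    filter_upwards [eventually_ne_atTop 0] with m hm
    have : NeZero m := ⟨hm⟩
    obtain ⟨QX, QY, hQ⟩ := h m
    simpa only [Fintype.card_fin] using hQ.rpow_sub_exp_le hX hY hA hB hη.le
  have hlim : Tendsto (fun η : ℝ => (μ.real (X ⁻¹' A) + η) * (μ.real (Y ⁻¹' B) + η)) (𝓝[>] 0)
      (𝓝 ((μ.real (X ⁻¹' A) + 0) * (μ.real (Y ⁻¹' B) + 0))) :=
    ((by fun_prop : Continuous _).tendsto 0).mono_left nhdsWithin_le_nhds
  have hreal := ge_of_tendsto hlim (eventually_mem_nhdsWithin.mono happrox)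
  rw [Measure.map_apply hX hA, Measure.map_apply hY hB,
    ← ENNReal.toReal_le_toReal (by finiteness) (by finiteness), ENNReal.toReal_mul,
    ← ENNReal.toReal_rpow]
  simpa only [add_zero, measureReal_def] using hreal

end SingleLetter

section DataProcessing

variable {Ω Ω' 𝒳 𝒴 𝒳' 𝒴' : Type*} [MeasurableSpace Ω] [MeasurableSpace Ω'] [MeasurableSpace 𝒳]
  [MeasurableSpace 𝒴] [MeasurableSpace 𝒳'] [MeasurableSpace 𝒴'] {X : Ω → 𝒳} {Y : Ω → 𝒴}
  {μ : Measure Ω} {ν : Measure Ω'}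

theorem wringingDependence_comp_le {φ : 𝒳 → 𝒳'} {ψ : 𝒴 → 𝒴'} (hφ : Measurable φ)
    (hψ : Measurable ψ) :
    wringingDependence (φ ∘ X) (ψ ∘ Y) μ ≤ wringingDependence X Y μ := by
  refine le_iInf₂ fun QX QY =>
    iInf₂_le_of_le (QX.map hφ.aemeasurable) (QY.map hψ.aemeasurable) ?_
  refine iSup₂_le fun A hA => iSup₂_le fun B hB => ?_
  refine le_iSup₂_of_le (φ ⁻¹' A) (hφ hA) (le_iSup₂_of_le (ψ ⁻¹' B) (hψ hB) ?_)
  rw [ProbabilityMeasure.toMeasure_map, ProbabilityMeasure.toMeasure_map,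
    Measure.map_apply hφ hA, Measure.map_apply hψ hB, Set.preimage_comp, Set.preimage_comp]

theorem wringingDependence_eq_of_identDistrib {X' : Ω' → 𝒳} {Y' : Ω' → 𝒴}
    (h : IdentDistrib (fun ω => (X ω, Y ω)) (fun ω => (X' ω, Y' ω)) μ ν) :
    wringingDependence X Y μ = wringingDependence X' Y' ν := by
  have hrect {A : Set 𝒳} {B : Set 𝒴} (hA : MeasurableSet A) (hB : MeasurableSet B) :
      μ (X ⁻¹' A ∩ Y ⁻¹' B) = ν (X' ⁻¹' A ∩ Y' ⁻¹' B) :=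
    h.measure_mem_eq (hA.prod hB)
  simp +contextual only [wringingDependence, hrect]

theorem identDistrib_comp_measurePreserving {Z : Ω → 𝒳} {T : Ω' → Ω} (hZ : AEMeasurable Z μ)
    (hT : MeasurePreserving T ν μ) : IdentDistrib Z (Z ∘ T) μ ν where
  aemeasurable_fst := hZ
  aemeasurable_snd := hZ.comp_quasiMeasurePreserving hT.quasiMeasurePreserving
  map_eq := by
    rw [← AEMeasurable.map_map_of_aemeasurable (hT.map_eq.symm ▸ hZ) hT.aemeasurable, hT.map_eq]

theorem wringingDependence_le_of_measurePreserving {X' : Ω' → 𝒳'} {Y' : Ω' → 𝒴'} {T : Ω' → Ω}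
    (hX : Measurable X) (hY : Measurable Y) (hT : MeasurePreserving T ν μ) {φ : 𝒳' → 𝒳}
    {ψ : 𝒴' → 𝒴} (hφ : Measurable φ) (hψ : Measurable ψ) (hφX : X ∘ T = φ ∘ X')
    (hψY : Y ∘ T = ψ ∘ Y') :
    wringingDependence X Y μ ≤ wringingDependence X' Y' ν := by
  have hid : IdentDistrib (fun ω => (X ω, Y ω)) (fun ω' => ((X ∘ T) ω', (Y ∘ T) ω')) μ ν :=
    identDistrib_comp_measurePreserving (hX.prodMk hY).aemeasurable hT
  rw [wringingDependence_eq_of_identDistrib hid, hφX, hψY]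
  exact wringingDependence_comp_le hφ hψ

end DataProcessing

section IID

variable {Ω 𝒳 𝒴 : Type*} [MeasurableSpace Ω] [MeasurableSpace 𝒳] [MeasurableSpace 𝒴]
  {X : Ω → 𝒳} {Y : Ω → 𝒴} {μ : Measure Ω}

/-- The wringing dependence `Δ(X^n;Y^n)` of `n` independent copies of `(X, Y)`, realised on the
product space `Fin n → Ω`. -/
noncomputable def iidDependence (X : Ω → 𝒳) (Y : Ω → 𝒴) (μ : Measure Ω) (n : ℕ) : ℝ≥0∞ :=
  wringingDependence (coordwise X) (coordwise Y) (Measure.pi fun _ : Fin n => μ)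

theorem identDistrib_pi_of_iIndepFun {ι Ω' E : Type*} [Fintype ι] [MeasurableSpace Ω']
    [MeasurableSpace E] [IsProbabilityMeasure μ] {ν : Measure Ω'} {Z : Ω → E} {W : ι → Ω' → E}
    (hind : iIndepFun W ν) (hid : ∀ i, IdentDistrib (W i) Z ν μ) :
    IdentDistrib (fun ω i => W i ω) (coordwise Z) ν (Measure.pi fun _ : ι => μ) := by
  have hcoord (i : ι) : IdentDistrib (W i) (fun ω : ι → Ω => Z (ω i)) ν (Measure.pi fun _ => μ) :=
    (hid i).trans <| identDistrib_comp_measurePreserving (hid i).aemeasurable_snd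
      (measurePreserving_eval (fun _ => μ) i)
  exact IdentDistrib.pi hcoord hind (iIndepFun_pi fun i => (hid i).aemeasurable_snd)

theorem wringingDependence_eq_iidDependence [IsProbabilityMeasure μ] {n : ℕ} {Ω' : Type*}
    [MeasurableSpace Ω'] {ν : Measure Ω'} {Xv : Ω' → Fin n → 𝒳} {Yv : Ω' → Fin n → 𝒴}
    (hind : iIndepFun (fun t ω => (Xv ω t, Yv ω t)) ν)
    (hid : ∀ t, IdentDistrib (fun ω => (Xv ω t, Yv ω t)) (fun ω => (X ω, Y ω)) ν μ) :
    wringingDependence Xv Yv ν = iidDependence X Y μ n := by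
  have hunzip : Measurable fun z : Fin n → 𝒳 × 𝒴 => (fun t => (z t).1, fun t => (z t).2) := by
    fun_prop
  exact wringingDependence_eq_of_identDistrib
    ((identDistrib_pi_of_iIndepFun hind hid).comp hunzip)

theorem monotone_iidDependence [IsProbabilityMeasure μ] (hX : Measurable X) (hY : Measurable Y) :
    Monotone (iidDependence X Y μ) := fun _ _ h =>
  wringingDependence_le_of_measurePreserving (measurable_coordwise hX) (measurable_coordwise hY)
    (measurePreserving_pi_comp μ (Fin.castLE_injective h))
    (φ := fun x i => x (Fin.castLE h i)) (ψ := fun y i => y (Fin.castLE h i))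
    (by fun_prop) (by fun_prop) rfl rfl

theorem iidDependence_coordwise_le [IsProbabilityMeasure μ] (hX : Measurable X)
    (hY : Measurable Y) (m k : ℕ) :
    iidDependence (coordwise X) (coordwise Y) (Measure.pi fun _ : Fin k => μ) m ≤
      iidDependence X Y μ (m * k) :=
  wringingDependence_le_of_measurePreserving (measurable_coordwise (measurable_coordwise hX))
    (measurable_coordwise (measurable_coordwise hY))
    ((measurePreserving_pi_curry μ).comp
      (measurePreserving_pi_comp μ finProdFinEquiv.injective))
    (φ := fun x i j => x (finProdFinEquiv (i, j))) (ψ := fun y i j => y (finProdFinEquiv (i, j)))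
    (by fun_prop) (by fun_prop) rfl rfl

theorem holderConjugate_one_add_one_div (δ : ℝ≥0∞) :
    (1 + 1 / δ).HolderConjugate (1 + δ) := by
  have h := ENNReal.HolderConjugate.conjExponent (le_self_add : 1 ≤ 1 + δ)
  rw [ENNReal.conjExponent, ENNReal.add_sub_cancel_left ENNReal.one_ne_top, ← one_div] at h
  exact h.symm

theorem bilinearBound_of_mem_ribbon_one_add [IsFiniteMeasure μ] (hX : Measurable X)
    (hY : Measurable Y) {δ : ℝ≥0}
    (h : (((1 + 1 / (δ : ℝ≥0∞) : ℝ≥0∞) : EReal), ((1 + (δ : ℝ≥0∞) : ℝ≥0∞) : EReal))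
      ∈ ribbon X Y μ) : BilinearBound X Y μ (1 + δ) (1 + δ) := by
  have := holderConjugate_one_add_one_div (δ : ℝ≥0∞)
  refine bilinearBound_of_mem_ribbon (r := 1 + 1 / δ) hX hY ?_ h
  exact ENNReal.lt_add_right ENNReal.one_ne_top (by simp)

theorem BilinearBound.wringingDependence_le [IsProbabilityMeasure μ] {δ : ℝ≥0}
    (hX : Measurable X) (hY : Measurable Y) (h : BilinearBound X Y μ (1 + δ) (1 + δ)) :
    wringingDependence X Y μ ≤ δ :=
  have := Measure.isProbabilityMeasure_map (μ := μ) hX.aemeasurable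
  have := Measure.isProbabilityMeasure_map (μ := μ) hY.aemeasurable
  (h.rectangleBound hX hY).wringingDependence_le

theorem wringingDependence_le_hypDependence [IsProbabilityMeasure μ] (hX : Measurable X)
    (hY : Measurable Y) : wringingDependence X Y μ ≤ hypDependence X Y μ :=
  le_iInf fun _ => le_iInf₂ fun _ hδ =>
    (bilinearBound_of_mem_ribbon_one_add hX hY hδ).wringingDependence_le hX hY

theorem iidDependence_le_hypDependence [IsProbabilityMeasure μ] (hX : Measurable X)
    (hY : Measurable Y) (n : ℕ) : iidDependence X Y μ n ≤ hypDependence X Y μ :=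
  le_iInf fun _ => le_iInf₂ fun _ hδ =>
    ((bilinearBound_of_mem_ribbon_one_add hX hY hδ).pi (by simp) (by finiteness) (by simp)
      (by finiteness) hX hY n).wringingDependence_le
      (measurable_coordwise hX) (measurable_coordwise hY)

theorem BilinearBound.hypDependence_le [IsFiniteMeasure μ] (hX : Measurable X) {δ : ℝ≥0}
    (hδ₀ : 0 < δ) (hδ₁ : δ ≤ 1) (h : BilinearBound X Y μ (1 + δ) (1 + δ)) :
    hypDependence X Y μ ≤ δ := by
  have := holderConjugate_one_add_one_div (δ : ℝ≥0∞)
  have hδ : (δ : ℝ≥0∞) ≤ 1 / δ := by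
    have hle : (δ : ℝ≥0∞) ≤ 1 := by exact_mod_cast hδ₁
    rw [one_div]
    exact hle.trans (ENNReal.one_le_inv.2 hle)
  exact iInf_le_of_le δ <| iInf₂_le_of_le hδ₁ (mem_ribbon_of_bilinearBound hX (by simp)
    (by gcongr) (by finiteness) (by finiteness) h) le_rfl

theorem hypDependence_le_one [IsFiniteMeasure μ] (hX : Measurable X) (hY : Measurable Y) :
    hypDependence X Y μ ≤ 1 := by
  have h : BilinearBound X Y μ (1 + (1 : ℝ≥0)) (1 + (1 : ℝ≥0)) := by
    simpa only [ENNReal.coe_one, one_add_one_eq_two] using bilinearBound_two hX hY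
  exact h.hypDependence_le hX one_pos le_rfl

theorem hypDependence_le_of_forall_iidDependence_lt [IsProbabilityMeasure μ] (hX : Measurable X)
    (hY : Measurable Y) {δ : ℝ≥0} (hδ : δ ≤ 1) (h : ∀ n, iidDependence X Y μ n < δ) :
    hypDependence X Y μ ≤ δ := by
  have hδ₀ : 0 < δ := by exact_mod_cast zero_le.trans_lt (h 0)
  refine BilinearBound.hypDependence_le hX hδ₀ hδ ?_
  refine bilinearBound_of_forall_rectangleBound_pi hX hY fun k => ?_
  refine rectangleBound_map_of_forall_pi (measurable_coordwise hX) (measurable_coordwise hY)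
    fun m => ?_
  exact exists_rectangleBound_of_wringingDependence_lt
    ((iidDependence_coordwise_le hX hY m k).trans_lt (h (m * k)))

theorem iSup_iidDependence [IsProbabilityMeasure μ] (hX : Measurable X) (hY : Measurable Y) :
    ⨆ n, iidDependence X Y μ n = hypDependence X Y μ := by
  refine le_antisymm (iSup_le (iidDependence_le_hypDependence hX hY)) ?_
  by_contra! hlt
  obtain ⟨δ, hsup, hδ⟩ := ENNReal.lt_iff_exists_nnreal_btwn.1 hlt
  have hδ₁ : δ ≤ 1 := by exact_mod_cast hδ.le.trans (hypDependence_le_one hX hY)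
  exact hδ.not_ge (hypDependence_le_of_forall_iidDependence_lt hX hY hδ₁ fun n =>
    (le_iSup _ n).trans_lt hsup)

end IID

end Wringing

theorem mainTheorem10
    {Ω 𝒳 𝒴 : Type*} [MeasurableSpace Ω] [MeasurableSpace 𝒳] [MeasurableSpace 𝒴]
    (μ : Measure Ω) [IsProbabilityMeasure μ]
    (X : Ω → 𝒳) (Y : Ω → 𝒴) (hX : Measurable X) (hY : Measurable Y) :
    Wringing.wringingDependence X Y μ ≤ Wringing.hypDependence X Y μ ∧
    -- for each `n`, random vectors `X^n`, `Y^n` (on any probability space) whose coordinate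
    -- pairs are i.i.d. with the law of `(X, Y)`
    ∀ (Ω' : ℕ → Type*) [∀ n, MeasurableSpace (Ω' n)]
      (ν : ∀ n, Measure (Ω' n)) [∀ n, IsProbabilityMeasure (ν n)]
      (Xv : ∀ n, Ω' n → Fin n → 𝒳) (Yv : ∀ n, Ω' n → Fin n → 𝒴),
      (∀ n, Measurable (Xv n)) → (∀ n, Measurable (Yv n)) →
      (∀ n, iIndepFun (fun (t : Fin n) (ω : Ω' n) => (Xv n ω t, Yv n ω t)) (ν n)) →
      (∀ n (t : Fin n), IdentDistrib (fun ω : Ω' n => (Xv n ω t, Yv n ω t))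
        (fun ω : Ω => (X ω, Y ω)) (ν n) μ) →
      Monotone (fun n => Wringing.wringingDependence (Xv n) (Yv n) (ν n)) ∧
      Tendsto (fun n => Wringing.wringingDependence (Xv n) (Yv n) (ν n)) atTop
        (𝓝 (Wringing.hypDependence X Y μ)) := by
  refine ⟨Wringing.wringingDependence_le_hypDependence hX hY, ?_⟩
  intro Ω' _ ν _ Xv Yv _ _ hind hid
  have hiid : (fun n => Wringing.wringingDependence (Xv n) (Yv n) (ν n)) =
      Wringing.iidDependence X Y μ :=
    funext fun n => Wringing.wringingDependence_eq_iidDependence (hind n) (hid n)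
  have hmono : Monotone (Wringing.iidDependence X Y μ) := Wringing.monotone_iidDependence hX hY
  rw [hiid, ← Wringing.iSup_iidDependence hX hY]
  exact ⟨hmono, tendsto_atTop_iSup hmono⟩
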